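/- Let $h$ be a Euclidean metric (a positive definite symmetric bilinear form) on $\mathbb{R}^n$, with components $h_{ij}$ and inverse $h^{ij}$, let $\kappa>0$, and let $P$ be a homogeneous cubic polynomial on $\mathbb{R}^n$ that solves $$\Delta_h P = h^{ij}\partial_i\partial_j P = 0,\qquad |\mathrm{Hess}\,P|_h^2 = h^{ik}h^{jl}(\partial_i\partial_jP)(\partial_k\partial_lP) = \kappa\,|x|_h^2 .$$ Let $\mathrm{Aut}(P)=\{g\in O(h): P(gx)=P(x)\text{ for all }x\in\mathbb{R}^n\}$ be the automorphism group of $P$, a closed subgroup of the orthogonal group $O(h)$ and hence a Lie group. If $\mathrm{Aut}(P)$ has positive dimension, then $n\ge 5$. -/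

import Mathlib

namespace EinsteinPolynomial

open MvPolynomial

/-- The `h`-Laplacian `h^{ij} D_i D_j P` of a polynomial on `ℝⁿ`, where `h` is the Gram matrix of a
metric on `ℝⁿ` and `h^{ij}` are the entries of the inverse matrix. -/
noncomputable def laplacian {n : ℕ} (h : Matrix (Fin n) (Fin n) ℝ)
    (P : MvPolynomial (Fin n) ℝ) : MvPolynomial (Fin n) ℝ :=
  ∑ i, ∑ j, C (h⁻¹ i j) * pderiv i (pderiv j P)

/-- The squared norm `h^{ik} h^{jl} P_{ij} P_{kl}` of the Hessian of a polynomial on `ℝⁿ`, by complete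
contraction with the inverse metric; it is again a polynomial on `ℝⁿ`. -/
noncomputable def hessNormSq {n : ℕ} (h : Matrix (Fin n) (Fin n) ℝ)
    (P : MvPolynomial (Fin n) ℝ) : MvPolynomial (Fin n) ℝ :=
  ∑ i, ∑ j, ∑ k, ∑ l,
    C (h⁻¹ i k * h⁻¹ j l) * (pderiv i (pderiv j P) * pderiv k (pderiv l P))

/-- The quadratic polynomial `|x|² = h_{ij} x^i x^j` of the metric `h`. -/
noncomputable def normSq {n : ℕ} (h : Matrix (Fin n) (Fin n) ℝ) : MvPolynomial (Fin n) ℝ :=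
  ∑ i, ∑ j, C (h i j) * (X i * X j)

/-- `P` is a homogeneous cubic polynomial on `ℝⁿ` that solves the system
`Δ_h P = 0`, `|Hess P|²_h = κ |x|²_h`. -/
structure IsSolution {n : ℕ} (h : Matrix (Fin n) (Fin n) ℝ) (κ : ℝ)
    (P : MvPolynomial (Fin n) ℝ) : Prop where
  homogeneous : P.IsHomogeneous 3
  harmonic : laplacian h P = 0
  hess : hessNormSq h P = C κ * normSq h

/-- The automorphism group of a polynomial `P` on the metric vector space `(ℝⁿ, h)`: the subgroup of
`GL(n, ℝ)` of the linear isometries of `h` that preserve `P`. -/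
def automorphismGroup {n : ℕ} (h : Matrix (Fin n) (Fin n) ℝ)
    (P : MvPolynomial (Fin n) ℝ) : Subgroup (GL (Fin n) ℝ) where
  carrier := {g | (g : Matrix (Fin n) (Fin n) ℝ).transpose * h * (g : Matrix (Fin n) (Fin n) ℝ) = h ∧
    ∀ x : Fin n → ℝ, eval ((g : Matrix (Fin n) (Fin n) ℝ).mulVec x) P = eval x P}
  one_mem' := by simp
  mul_mem' := by
    rintro a b ⟨ha, ha'⟩ ⟨hb, hb'⟩
    refine ⟨?_, fun x => ?_⟩
    · rw [Units.val_mul, Matrix.transpose_mul]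
      calc _ = (b : Matrix (Fin n) (Fin n) ℝ).transpose *
            ((a : Matrix (Fin n) (Fin n) ℝ).transpose * h * (a : Matrix (Fin n) (Fin n) ℝ)) *
            (b : Matrix (Fin n) (Fin n) ℝ) := by simp only [Matrix.mul_assoc]
        _ = h := by rw [ha, hb]
    · rw [Units.val_mul, ← Matrix.mulVec_mulVec, ha', hb']
  inv_mem' := by
    rintro a ⟨ha, ha'⟩
    have e : (a : Matrix (Fin n) (Fin n) ℝ) * (a⁻¹ : GL (Fin n) ℝ) = 1 := a.mul_inv
    have e' := congrArg Matrix.transpose e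
    rw [Matrix.transpose_mul, Matrix.transpose_one] at e'
    refine ⟨?_, fun x => ?_⟩
    · calc _ = ((a⁻¹ : GL (Fin n) ℝ) : Matrix (Fin n) (Fin n) ℝ).transpose *
            ((a : Matrix (Fin n) (Fin n) ℝ).transpose * h * (a : Matrix (Fin n) (Fin n) ℝ)) *
            ((a⁻¹ : GL (Fin n) ℝ) : Matrix (Fin n) (Fin n) ℝ) := by rw [ha]
        _ = (((a⁻¹ : GL (Fin n) ℝ) : Matrix (Fin n) (Fin n) ℝ).transpose *
              (a : Matrix (Fin n) (Fin n) ℝ).transpose) * h *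
            ((a : Matrix (Fin n) (Fin n) ℝ) * ((a⁻¹ : GL (Fin n) ℝ) : Matrix (Fin n) (Fin n) ℝ)) := by
              simp only [Matrix.mul_assoc]
        _ = h := by rw [e, e', Matrix.one_mul, Matrix.mul_one]
    · rw [← ha', Matrix.mulVec_mulVec, e, Matrix.one_mulVec]

/-- The Lie algebra of a closed subgroup `G` of `GL(n, ℝ)`: the matrices `X` such that `exp (t X)` lies
in `G` for all real `t`. For closed `G` these matrices already form a linear subspace, so that taking the
linear span adds nothing and only serves to bundle them as a submodule. -/
noncomputable def lieAlgebra {n : ℕ} (G : Subgroup (GL (Fin n) ℝ)) :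
    Submodule ℝ (Matrix (Fin n) (Fin n) ℝ) :=
  Submodule.span ℝ {X | ∀ t : ℝ, ∃ g ∈ G, (g : Matrix (Fin n) (Fin n) ℝ) = NormedSpace.exp (t • X)}

/-- The dimension, as a Lie group, of a closed subgroup of `GL(n, ℝ)`: the dimension of its Lie
algebra. -/
noncomputable def lieDimension {n : ℕ} (G : Subgroup (GL (Fin n) ℝ)) : ℕ :=
  Module.finrank ℝ (lieAlgebra G)

end EinsteinPolynomial

/-!
By homogeneity the third derivatives of `P` form a symmetric trilinear form determining the
Hessian of `P`, and with `h` they define a commutative multiplication `μ` on `ℝⁿ` whose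
multiplication operators are self-adjoint and, by the two equations for `P`, satisfy `tr (μ x) = 0`
and `tr (μ x ∘ μ x) = κ |x|²`. A nonzero element of the Lie algebra of `Aut(P)` is a nonzero skew
derivation `A` of this algebra.

Suppose `A` rotates three planes with frequencies `p, q, r`. If the trilinear form is nonzero on the
product of these planes, its invariance under `A` forces a relation `±p ± q ± r = 0`. In dimension
at most four this leaves two cases. If `A` has two nonzero frequencies `p` and `q`, the trace
conditions force both mixed blocks to be nonzero, whence `q² = 4p²` and `p² = 4q²`, which is absurd.
Otherwise `A` rotates one plane and has a kernel of dimension `d ≤ 2`. The multiplications by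
vectors of the kernel act on the plane as scalars, so the norm of the restriction of the form to the
kernel is determined by that of its trace; this violates the inequality `3 |tr t|² ≤ (d + 2) |t|²`
for a symmetric cubic tensor `t` in dimension `d`.
-/

namespace EinsteinPolynomial

open MvPolynomial
open scoped Matrix

/-- For `α = -a²`, `β = -b²`, `γ = -c²` the scalar factor is Heron's product
`(a + b + c) (a + b - c) (a - b + c) (a - b - c)`, which vanishes iff `±a ± b ± c = 0`. -/
theorem heron_mul_eq_zero {R M : Type*} [CommRing R] [AddCommGroup M] [Module R M]
    {T : M →ₗ[R] M →ₗ[R] M →ₗ[R] R} {A : Module.End R M}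
    (hT : ∀ x y z, T (A x) y z + T x (A y) z + T x y (A z) = 0) {α β γ : R} {x y z : M}
    (hx : A (A x) = α • x) (hy : A (A y) = β • y) (hz : A (A z) = γ • z) :
    ((γ - α - β) ^ 2 - 4 * α * β) * T x y z = 0 := by
  have two_mul_apply {x y : M} (hx : A (A x) = α • x) (hy : A (A y) = β • y) :
      2 * T (A x) (A y) z = (γ - α - β) * T x y z := by
    have h₁ := hT (A x) y z
    have h₂ := hT x (A y) z
    have h₃ := hT x y (A z)
    simp only [hx, hy, hz, map_smul, LinearMap.smul_apply, smul_eq_mul] at h₁ h₂ h₃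
    linear_combination h₁ + h₂ - h₃
  have h := two_mul_apply (x := A x) (y := A y) (by simp [hx]) (by simp [hy])
  simp only [hx, hy, map_smul, LinearMap.smul_apply, smul_eq_mul] at h
  linear_combination (α + β - γ) * two_mul_apply hx hy - 2 * h

section Trace

variable {ι : Type*} [Fintype ι]

/-- The symmetric 3-tensor `δ_{ab} τ_c + δ_{ac} τ_b + δ_{bc} τ_a`, a pure-trace tensor whose trace
is `card ι + 2` times `τ`. -/
def pureTrace [DecidableEq ι] (τ : ι → ℝ) (a b c : ι) : ℝ :=
  (if a = b then τ c else 0) + (if a = c then τ b else 0) + if b = c then τ a else 0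

theorem sum_pureTrace_diag [DecidableEq ι] (τ : ι → ℝ) (c : ι) :
    ∑ a, pureTrace τ a a c = (Fintype.card ι + 2) * τ c := by
  simp only [pureTrace, if_true, Finset.sum_add_distrib, Finset.sum_const, Finset.card_univ,
    nsmul_eq_mul, Finset.sum_ite_eq', Finset.mem_univ]
  ring

theorem sum_pureTrace_mul [DecidableEq ι] (τ : ι → ℝ) {t : ι → ι → ι → ℝ}
    (h₁₂ : ∀ a b c, t a b c = t b a c) (h₂₃ : ∀ a b c, t a b c = t a c b) :
    ∑ a, ∑ b, ∑ c, pureTrace τ a b c * t a b c = 3 * ∑ c, τ c * ∑ a, t a a c := by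
  have hab : ∑ a, ∑ b, ∑ c, (if a = b then τ c else 0) * t a b c = ∑ c, τ c * ∑ a, t a a c := by
    simp only [ite_mul, zero_mul, Finset.sum_ite_irrel, Finset.sum_const_zero,
      Finset.sum_ite_eq, Finset.mem_univ, if_true, Finset.mul_sum]
    exact Finset.sum_comm
  have hac : ∑ a, ∑ b, ∑ c, (if a = c then τ b else 0) * t a b c = ∑ c, τ c * ∑ a, t a a c := by
    rw [← hab]
    refine Finset.sum_congr rfl fun a _ => Finset.sum_comm.trans ?_
    simp only [h₂₃ a]
  have hbc : ∑ a, ∑ b, ∑ c, (if b = c then τ a else 0) * t a b c = ∑ c, τ c * ∑ a, t a a c := by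
    rw [← hac]
    refine Finset.sum_comm.trans ?_
    simp only [h₁₂]
  simp only [pureTrace, add_mul, Finset.sum_add_distrib, hab, hac, hbc]
  ring

theorem three_mul_sum_trace_sq_le {t : ι → ι → ι → ℝ}
    (h₁₂ : ∀ a b c, t a b c = t b a c) (h₂₃ : ∀ a b c, t a b c = t a c b) :
    3 * ∑ c, (∑ a, t a a c) ^ 2 ≤ (Fintype.card ι + 2) * ∑ a, ∑ b, ∑ c, t a b c ^ 2 := by
  classical
  set r : ℝ := Fintype.card ι + 2 with hr
  let s := pureTrace fun c => ∑ a, t a a c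
  have hst : ∑ a, ∑ b, ∑ c, s a b c * t a b c = 3 * ∑ c, (∑ a, t a a c) ^ 2 := by
    simp only [s, sum_pureTrace_mul _ h₁₂ h₂₃, sq]
  have hss : ∑ a, ∑ b, ∑ c, s a b c * s a b c = 3 * r * ∑ c, (∑ a, t a a c) ^ 2 := by
    rw [sum_pureTrace_mul _ (fun a b c => ?_) fun a b c => ?_]
    · simp only [s, sum_pureTrace_diag, ← hr, mul_left_comm _ r, ← Finset.mul_sum, ← sq, mul_assoc]
    · simp only [s, pureTrace, eq_comm (a := b)]; ring
    · simp only [s, pureTrace, eq_comm (a := c)]; ring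
  have hsq : ∑ a, ∑ b, ∑ c, (r * t a b c - s a b c) ^ 2 =
      r * (r * ∑ a, ∑ b, ∑ c, t a b c ^ 2 - 3 * ∑ c, (∑ a, t a a c) ^ 2) := by
    trans r ^ 2 * (∑ a, ∑ b, ∑ c, t a b c ^ 2) - 2 * r * (∑ a, ∑ b, ∑ c, s a b c * t a b c) +
      ∑ a, ∑ b, ∑ c, s a b c * s a b c
    · simp only [Finset.mul_sum, ← Finset.sum_sub_distrib, ← Finset.sum_add_distrib]
      congr! 6
      ring
    · rw [hst, hss]; ring
  have h : 0 ≤ r * (r * ∑ a, ∑ b, ∑ c, t a b c ^ 2 - 3 * ∑ c, (∑ a, t a a c) ^ 2) := by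
    rw [← hsq]; positivity
  linarith [nonneg_of_mul_nonneg_right h (by positivity : 0 < r)]

end Trace

open scoped RealInnerProductSpace

variable {E : Type*} [NormedAddCommGroup E] [InnerProductSpace ℝ E]

section Rotation

variable {A : E →ₗ[ℝ] E}

/-- `A` preserves the plane spanned by the pair `e`, on which it is an infinitesimal rotation with
angular speed `p`. -/
structure IsRotationOn (A : E →ₗ[ℝ] E) (e : Fin 2 → E) (p : ℝ) : Prop where
  apply_zero : A (e 0) = p • e 1
  apply_one : A (e 1) = -p • e 0

theorem IsRotationOn.apply_apply {e : Fin 2 → E} {p : ℝ} (h : IsRotationOn A e p) (i : Fin 2) :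
    A (A (e i)) = -p ^ 2 • e i := by
  fin_cases i <;> simp [h.apply_zero, h.apply_one, smul_smul, sq]

theorem IsRotationOn.apply_mem_orthogonal {u : Fin 2 → E} {p : ℝ} (hu : IsRotationOn A u p)
    (hA : ∀ x y, ⟪A x, y⟫ = -⟪x, A y⟫) {w : E} (hw : w ∈ (Submodule.span ℝ (Set.range u))ᗮ) :
    A w ∈ (Submodule.span ℝ (Set.range u))ᗮ := by
  rw [Submodule.mem_orthogonal] at hw ⊢
  intro y hy
  rw [← neg_eq_zero, ← hA]
  refine hw _ ?_
  have hmap : Submodule.span ℝ (Set.range u) ≤ (Submodule.span ℝ (Set.range u)).comap A := by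
    have mem (i : Fin 2) := Submodule.subset_span (R := ℝ) (Set.mem_range_self (f := u) i)
    rw [Submodule.span_le, Set.range_subset_iff, Fin.forall_fin_two]
    simp only [SetLike.mem_coe, Submodule.mem_comap, hu.apply_zero, hu.apply_one]
    exact ⟨Submodule.smul_mem _ _ (mem 1), Submodule.smul_mem _ _ (mem 0)⟩
  exact hmap hy

theorem exists_orthonormal_isRotationOn [FiniteDimensional ℝ E]
    (hA : ∀ x y, ⟪A x, y⟫ = -⟪x, A y⟫) (hA0 : A ≠ 0) :
    ∃ (e : Fin 2 → E) (p : ℝ), Orthonormal ℝ e ∧ p ≠ 0 ∧ IsRotationOn A e p := by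
  have hS : (A ∘ₗ A).IsSymmetric := fun x y => by simp [hA]
  have inner_apply_self (x : E) : ⟪x, A x⟫ = 0 := by
    linarith [hA x x, real_inner_comm x (A x)]
  obtain ⟨e, l, he, hAA, hAe⟩ : ∃ (e : E) (l : ℝ), ‖e‖ = 1 ∧ A (A e) = l • e ∧ A e ≠ 0 := by
    let b := hS.eigenvectorBasis rfl
    obtain ⟨i, hi⟩ : ∃ i, A (b i) ≠ 0 := by
      by_contra! h
      exact hA0 (b.toBasis.ext fun i => by simpa using h i)
    exact ⟨b i, _, b.norm_eq_one i, hS.apply_eigenvectorBasis rfl i, hi⟩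
  have hp : 0 < ‖A e‖ := norm_pos_iff.2 hAe
  have hl : l = -‖A e‖ ^ 2 := by
    have h := hA (A e) e
    rw [hAA, real_inner_smul_left, real_inner_self_eq_norm_sq, real_inner_self_eq_norm_sq, he] at h
    simpa using h
  refine ⟨![e, ‖A e‖⁻¹ • A e], ‖A e‖, ?_, hp.ne', ?_, ?_⟩
  · simp [orthonormal_vecCons_iff, he, norm_smul, hp.ne', real_inner_smul_right, inner_apply_self]
  · simp [hp.ne']
  · simp [hAA, hl, smul_smul, sq, hp.ne']

end Rotation

theorem orthonormal_sumElim {ι κ : Type*} {e : ι → E} {f : κ → E} (he : Orthonormal ℝ e)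
    (hf : Orthonormal ℝ f) (hef : ∀ i j, ⟪e i, f j⟫ = 0) : Orthonormal ℝ (Sum.elim e f) := by
  classical
  rw [orthonormal_iff_ite] at he hf ⊢
  rintro (i | i) (j | j) <;> simp [he, hf, hef, real_inner_comm]

theorem exists_orthonormalBasis_eq_sumElim [FiniteDimensional ℝ E] {ι κ : Type*} [Fintype ι]
    [Fintype κ] {e : ι → E} (he : Orthonormal ℝ e) {f : κ → (Submodule.span ℝ (Set.range e))ᗮ}
    (hf : Orthonormal ℝ f)
    (hcard : Fintype.card κ = Module.finrank ℝ (Submodule.span ℝ (Set.range e))ᗮ) :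
    ∃ b : OrthonormalBasis (ι ⊕ κ) ℝ E, ⇑b = Sum.elim e (fun k => (f k : E)) := by
  have hon : Orthonormal ℝ (Sum.elim e fun k => (f k : E)) :=
    orthonormal_sumElim he (hf.comp_linearIsometry (Submodule.subtypeₗᵢ _)) fun i k =>
      Submodule.inner_right_of_mem_orthogonal
        (Submodule.subset_span (Set.mem_range_self i)) (f k).2
  have hd : Fintype.card (ι ⊕ κ) = Module.finrank ℝ E := by
    rw [Fintype.card_sum, hcard, ← finrank_span_eq_card he.linearIndependent,
      Submodule.finrank_add_finrank_orthogonal]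
  exact ⟨.mk hon (hon.linearIndependent.span_eq_top_of_card_eq_finrank' hd).ge, by simp⟩

/-- An exact Killing metrized commutative algebra: a commutative multiplication `μ` on a Euclidean
space whose multiplication operators are self-adjoint and trace-free, and whose trace form
`(x, y) ↦ tr (μ x ∘ μ y)` is `κ` times the inner product. The condition on the trace form is imposed
on the diagonal only, which suffices by polarization. -/
structure IsExactKillingMetrized (μ : E →ₗ[ℝ] E →ₗ[ℝ] E) (κ : ℝ) : Prop where
  comm : ∀ x y, μ x y = μ y x
  isSymmetric : ∀ x, (μ x).IsSymmetric
  trace_eq_zero : ∀ x, LinearMap.trace ℝ E (μ x) = 0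
  trace_comp_self : ∀ x, LinearMap.trace ℝ E (μ x ∘ₗ μ x) = κ * ⟪x, x⟫

/-- A skew-adjoint derivation of the algebra with multiplication `μ`: the infinitesimal version of
an isometric automorphism. -/
structure IsSkewDerivation (μ : E →ₗ[ℝ] E →ₗ[ℝ] E) (A : E →ₗ[ℝ] E) : Prop where
  inner_apply : ∀ x y, ⟪A x, y⟫ = -⟪x, A y⟫
  apply_mul : ∀ x y, A (μ x y) = μ (A x) y + μ x (A y)

section Algebra

variable {μ : E →ₗ[ℝ] E →ₗ[ℝ] E} {κ : ℝ} {A : E →ₗ[ℝ] E}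

theorem isSkewDerivation_iff : IsSkewDerivation μ A ↔ (∀ x y, ⟪A x, y⟫ = -⟪x, A y⟫) ∧
    ∀ x y z, ⟪μ (A x) y, z⟫ + ⟪μ x (A y), z⟫ + ⟪μ x y, A z⟫ = 0 := by
  refine ⟨fun hA => ⟨hA.inner_apply, fun x y z => ?_⟩, fun ⟨hA, hμA⟩ =>
    ⟨hA, fun x y => ext_inner_right ℝ fun z => ?_⟩⟩
  · rw [← inner_add_left, ← hA.apply_mul, hA.inner_apply, neg_add_cancel]
  · rw [hA, inner_add_left, eq_neg_of_add_eq_zero_left (hμA x y z)]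

namespace IsExactKillingMetrized

theorem inner_mul_swap₁₂ (hμ : IsExactKillingMetrized μ κ) (x y z : E) :
    ⟪μ x y, z⟫ = ⟪μ y x, z⟫ := by
  rw [hμ.comm]

theorem inner_mul_swap₂₃ (hμ : IsExactKillingMetrized μ κ) (x y z : E) :
    ⟪μ x y, z⟫ = ⟪μ x z, y⟫ := by
  rw [hμ.isSymmetric, real_inner_comm]

theorem sum_inner_mul_self (hμ : IsExactKillingMetrized μ κ) {ι : Type*} [Fintype ι]
    (b : OrthonormalBasis ι ℝ E) (z : E) : ∑ i, ⟪μ (b i) (b i), z⟫ = 0 := by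
  rw [← hμ.trace_eq_zero z, LinearMap.trace_eq_sum_inner _ b]
  exact Finset.sum_congr rfl fun i _ => by
    rw [hμ.isSymmetric, hμ.comm]

theorem sum_inner_mul_sq (hμ : IsExactKillingMetrized μ κ) {ι : Type*} [Fintype ι]
    (b : OrthonormalBasis ι ℝ E) (z : E) : ∑ i, ∑ j, ⟪μ z (b i), b j⟫ ^ 2 = κ * ‖z‖ ^ 2 := by
  rw [← real_inner_self_eq_norm_sq, ← hμ.trace_comp_self, LinearMap.trace_eq_sum_inner _ b]
  refine Finset.sum_congr rfl fun i _ => ?_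
  rw [b.sum_sq_inner_left, LinearMap.comp_apply, ← hμ.isSymmetric, real_inner_self_eq_norm_sq]

end IsExactKillingMetrized

/-- The squared norm of the block of the cubic form `⟪μ x y, z⟫` cut out by three families of
vectors. -/
def blockNormSq {ι₁ ι₂ ι₃ : Type*} [Fintype ι₁] [Fintype ι₂] [Fintype ι₃]
    (μ : E →ₗ[ℝ] E →ₗ[ℝ] E) (u : ι₁ → E) (v : ι₂ → E) (w : ι₃ → E) : ℝ :=
  ∑ i, ∑ j, ∑ k, ⟪μ (u i) (v j), w k⟫ ^ 2

section Blocks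

variable {ι₁ ι₂ ι₃ : Type*} [Fintype ι₁] [Fintype ι₂] [Fintype ι₃] {u : ι₁ → E} {v : ι₂ → E}
  {w : ι₃ → E}

theorem IsExactKillingMetrized.blockNormSq_swap₁₂ (hμ : IsExactKillingMetrized μ κ) (u : ι₁ → E)
    (v : ι₂ → E) (w : ι₃ → E) : blockNormSq μ u v w = blockNormSq μ v u w := by
  simp only [blockNormSq, hμ.inner_mul_swap₁₂ (u _)]
  exact Finset.sum_comm

theorem IsExactKillingMetrized.blockNormSq_swap₂₃ (hμ : IsExactKillingMetrized μ κ) (u : ι₁ → E)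
    (v : ι₂ → E) (w : ι₃ → E) : blockNormSq μ u v w = blockNormSq μ u w v := by
  simp only [blockNormSq, hμ.inner_mul_swap₂₃ _ (v _)]
  exact Finset.sum_congr rfl fun i _ => Finset.sum_comm

theorem IsSkewDerivation.heron_mul_blockNormSq (hA : IsSkewDerivation μ A) {α β γ : ℝ}
    (hu : ∀ i, A (A (u i)) = α • u i) (hv : ∀ i, A (A (v i)) = β • v i)
    (hw : ∀ i, A (A (w i)) = γ • w i) :
    ((γ - α - β) ^ 2 - 4 * α * β) * blockNormSq μ u v w = 0 := by
  have hT x y z : μ.compr₂ (innerₗ E) (A x) y z + μ.compr₂ (innerₗ E) x (A y) z +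
      μ.compr₂ (innerₗ E) x y (A z) = 0 := (isSkewDerivation_iff.1 hA).2 x y z
  simp only [blockNormSq, Finset.mul_sum]
  refine Finset.sum_eq_zero fun i _ => Finset.sum_eq_zero fun j _ => ?_
  refine Finset.sum_eq_zero fun k _ => ?_
  have h : ((γ - α - β) ^ 2 - 4 * α * β) * ⟪μ (u i) (v j), w k⟫ = 0 :=
    heron_mul_eq_zero hT (hu i) (hv j) (hw k)
  rw [sq ⟪_, _⟫, ← mul_assoc, h, zero_mul]

theorem IsExactKillingMetrized.card_left_mul_eq (hμ : IsExactKillingMetrized μ κ)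
    (b : OrthonormalBasis (ι₁ ⊕ ι₂) ℝ E) (hb : ⇑b = Sum.elim u v) :
    Fintype.card ι₁ * κ =
      blockNormSq μ u u u + 2 * blockNormSq μ u u v + blockNormSq μ u v v := by
  have hu (i : ι₁) : ‖u i‖ = 1 := by simpa [hb] using b.norm_eq_one (.inl i)
  have h : ∑ i, ∑ a, ∑ c, ⟪μ (u i) (b a), b c⟫ ^ 2 = Fintype.card ι₁ * κ := by
    simp only [hμ.sum_inner_mul_sq b, hu, one_pow, mul_one, Finset.sum_const, Finset.card_univ,
      nsmul_eq_mul]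
  have hswap := hμ.blockNormSq_swap₂₃ u u v
  simp only [hb, Fintype.sum_sum_type, Sum.elim_inl, Sum.elim_inr, Finset.sum_add_distrib,
    ← blockNormSq.eq_def] at h
  linarith

theorem IsExactKillingMetrized.card_right_mul_eq (hμ : IsExactKillingMetrized μ κ)
    (b : OrthonormalBasis (ι₁ ⊕ ι₂) ℝ E) (hb : ⇑b = Sum.elim u v) :
    Fintype.card ι₂ * κ =
      blockNormSq μ v v v + 2 * blockNormSq μ u v v + blockNormSq μ u u v := by
  have h := hμ.card_left_mul_eq (u := v) (v := u) (b.reindex (.sumComm ι₁ ι₂))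
    (by ext (i | i) <;> simp [hb])
  rwa [hμ.blockNormSq_swap₂₃ v v u, hμ.blockNormSq_swap₁₂ v u v, hμ.blockNormSq_swap₁₂ v u u,
    hμ.blockNormSq_swap₂₃ u v u] at h

end Blocks

section RotationPlanes

variable {u : Fin 2 → E} {p : ℝ}

theorem IsSkewDerivation.blockNormSq_self_eq_zero (hA : IsSkewDerivation μ A)
    (hu : IsRotationOn A u p) (hp : p ≠ 0) : blockNormSq μ u u u = 0 := by
  have h := hA.heron_mul_blockNormSq hu.apply_apply hu.apply_apply hu.apply_apply
  refine (mul_eq_zero.1 h).resolve_left ?_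
  have : p ^ 4 ≠ 0 := pow_ne_zero 4 hp
  contrapose! this
  linarith

/-- With frequencies `p, p, q` the Heron expression is `q² (q² - 4 p²)`. -/
theorem IsSkewDerivation.sub_mul_blockNormSq_eq_zero (hA : IsSkewDerivation μ A)
    {v : Fin 2 → E} {q : ℝ} (hu : IsRotationOn A u p) (hv : IsRotationOn A v q) (hq : q ≠ 0) :
    (q ^ 2 - 4 * p ^ 2) * blockNormSq μ u u v = 0 := by
  have h := hA.heron_mul_blockNormSq hu.apply_apply hu.apply_apply hv.apply_apply
  refine (mul_eq_zero.1 (?_ : q ^ 2 * _ = 0)).resolve_left (pow_ne_zero 2 hq)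
  linear_combination h

/-- The count of block norms makes `blockNormSq μ u u v` and `blockNormSq μ v v u` both nonzero,
which requires `q = ± 2 p` and `p = ± 2 q`. -/
theorem IsExactKillingMetrized.false_of_two_rotations (hμ : IsExactKillingMetrized μ κ)
    (hκ : κ ≠ 0) (hA : IsSkewDerivation μ A) {v : Fin 2 → E} {q : ℝ} (hp : p ≠ 0) (hq : q ≠ 0)
    (hu : IsRotationOn A u p) (hv : IsRotationOn A v q)
    (b : OrthonormalBasis (Fin 2 ⊕ Fin 2) ℝ E) (hb : ⇑b = Sum.elim u v) : False := by
  have h₁ := hμ.card_left_mul_eq b hb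
  have h₂ := hμ.card_right_mul_eq b hb
  have huuv := hA.sub_mul_blockNormSq_eq_zero hu hv hq
  have huvv := hA.sub_mul_blockNormSq_eq_zero hv hu hp
  rw [hμ.blockNormSq_swap₂₃, hμ.blockNormSq_swap₁₂] at huvv
  rw [hA.blockNormSq_self_eq_zero hu hp, Fintype.card_fin] at h₁
  rw [hA.blockNormSq_self_eq_zero hv hq, Fintype.card_fin] at h₂
  push_cast at h₁ h₂
  have hq2 := (mul_eq_zero.1 huuv).resolve_right fun h => hκ (by linarith)
  have hp2 := (mul_eq_zero.1 huvv).resolve_right fun h => hκ (by linarith)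
  exact hp (pow_eq_zero_iff two_ne_zero |>.1 (by linarith : p ^ 2 = 0))

variable {ι : Type*} [Fintype ι] {w : ι → E}

theorem IsSkewDerivation.inner_mul_pair_eq_zero (hA : IsSkewDerivation μ A)
    (hμ : IsExactKillingMetrized μ κ) (hu : IsRotationOn A u p) (hp : p ≠ 0) {z : E}
    (hz : A z = 0) : ⟪μ (u 0) (u 1), z⟫ = 0 := by
  have h := (isSkewDerivation_iff.1 hA).2 (u 0) (u 0) z
  simp only [hu.apply_zero, hz, map_smul, LinearMap.smul_apply, real_inner_smul_left,
    inner_zero_right, hμ.comm (u 1)] at h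
  exact (mul_eq_zero.1 (by linarith : p * _ = 0)).resolve_left hp

theorem IsSkewDerivation.inner_mul_self_pair_eq (hA : IsSkewDerivation μ A)
    (hu : IsRotationOn A u p) (hp : p ≠ 0) {z : E} (hz : A z = 0) :
    ⟪μ (u 1) (u 1), z⟫ = ⟪μ (u 0) (u 0), z⟫ := by
  have h := (isSkewDerivation_iff.1 hA).2 (u 0) (u 1) z
  simp only [hu.apply_zero, hu.apply_one, hz, map_smul, LinearMap.smul_apply, real_inner_smul_left,
    inner_zero_right] at h
  exact mul_left_cancel₀ hp (by linarith)

theorem IsExactKillingMetrized.sum_trace_sq_eq (hμ : IsExactKillingMetrized μ κ)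
    (hA : IsSkewDerivation μ A) (hp : p ≠ 0) (hu : IsRotationOn A u p) (hw : ∀ k, A (w k) = 0)
    (b : OrthonormalBasis (Fin 2 ⊕ ι) ℝ E) (hb : ⇑b = Sum.elim u w) :
    ∑ k, (∑ a, ⟪μ (w a) (w a), w k⟫) ^ 2 = 2 * blockNormSq μ u u w := by
  have hτ (k : ι) : ∑ a, ⟪μ (w a) (w a), w k⟫ = -2 * ⟪μ (u 0) (u 0), w k⟫ := by
    have h := hμ.sum_inner_mul_self b (w k)
    simp only [hb, Fintype.sum_sum_type, Sum.elim_inl, Sum.elim_inr, Fin.sum_univ_two,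
      hA.inner_mul_self_pair_eq hu hp (hw k)] at h
    linarith
  simp only [hτ, blockNormSq, Fin.sum_univ_two, hμ.comm (u 1) (u 0),
    hA.inner_mul_pair_eq_zero hμ hu hp (hw _), hA.inner_mul_self_pair_eq hu hp (hw _), mul_pow,
    ← Finset.mul_sum, zero_pow two_ne_zero, Finset.sum_const_zero]
  ring

/-- The trace of the kernel block has squared norm `2κ` while the block itself has squared norm
`(card ι - 1) κ`; the trace inequality then reads `6 ≤ (card ι + 2) (card ι - 1)`. -/
theorem IsExactKillingMetrized.three_le_card_of_apply_eq_zero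
    (hμ : IsExactKillingMetrized μ κ) (hκ : 0 < κ) (hA : IsSkewDerivation μ A) (hp : p ≠ 0)
    (hu : IsRotationOn A u p) (hw : ∀ k, A (w k) = 0)
    (b : OrthonormalBasis (Fin 2 ⊕ ι) ℝ E) (hb : ⇑b = Sum.elim u w) : 3 ≤ Fintype.card ι := by
  have hw2 (k : ι) : A (A (w k)) = (0 : ℝ) • w k := by simp [hw]
  have huww : blockNormSq μ u w w = 0 := by
    have h := hA.heron_mul_blockNormSq hu.apply_apply hw2 hw2
    refine (mul_eq_zero.1 (?_ : p ^ 4 * _ = 0)).resolve_left (pow_ne_zero 4 hp)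
    linear_combination h
  have h₁ := hμ.card_left_mul_eq b hb
  have h₂ := hμ.card_right_mul_eq b hb
  rw [hA.blockNormSq_self_eq_zero hu hp, huww, Fintype.card_fin] at h₁
  rw [huww] at h₂
  push_cast at h₁
  have htrace := three_mul_sum_trace_sq_le (t := fun a b c => ⟪μ (w a) (w b), w c⟫)
    (fun a b c => hμ.inner_mul_swap₁₂ _ _ _) fun a b c => hμ.inner_mul_swap₂₃ _ _ _
  rw [hμ.sum_trace_sq_eq hA hp hu hw b hb, ← blockNormSq] at htrace
  have hwww : blockNormSq μ w w w = (Fintype.card ι - 1) * κ := by linarith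
  have huuw : blockNormSq μ u u w = κ := by linarith
  have h : (6 : ℝ) ≤ (Fintype.card ι + 2) * (Fintype.card ι - 1) := by
    rw [hwww, huuw] at htrace
    refine le_of_mul_le_mul_right ?_ hκ
    linarith
  by_contra! hlt
  interval_cases Fintype.card ι <;> norm_num at h

end RotationPlanes

end Algebra

section FiniteDimensional

variable [FiniteDimensional ℝ E] {μ : E →ₗ[ℝ] E →ₗ[ℝ] E} {κ : ℝ} {A : E →ₗ[ℝ] E}

theorem IsExactKillingMetrized.five_le_finrank (hμ : IsExactKillingMetrized μ κ) (hκ : 0 < κ)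
    (hA : IsSkewDerivation μ A) (hA0 : A ≠ 0) : 5 ≤ Module.finrank ℝ E := by
  obtain ⟨u, p, hon, hp, hu⟩ := exists_orthonormal_isRotationOn hA.inner_apply hA0
  set W := (Submodule.span ℝ (Set.range u))ᗮ
  have hrank : 2 + Module.finrank ℝ W = Module.finrank ℝ E := by
    rw [← Submodule.finrank_add_finrank_orthogonal (Submodule.span ℝ (Set.range u)),
      finrank_span_eq_card hon.linearIndependent, Fintype.card_fin]
  by_cases hker : ∀ w : W, A w = 0
  · let f := stdOrthonormalBasis ℝ W
    obtain ⟨b, hb⟩ := exists_orthonormalBasis_eq_sumElim hon f.orthonormal (Fintype.card_fin _)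
    have := hμ.three_le_card_of_apply_eq_zero hκ hA hp hu (fun k => hker (f k)) b hb
    rw [Fintype.card_fin] at this
    omega
  · let B := A.restrict fun w hw => hu.apply_mem_orthogonal hA.inner_apply hw
    have hB0 : B ≠ 0 := fun h => hker fun w => congrArg Subtype.val (LinearMap.congr_fun h w)
    obtain ⟨v, q, honv, hq, hv⟩ :=
      exists_orthonormal_isRotationOn (A := B) (fun x y => hA.inner_apply (x : E) y) hB0
    have hvA : IsRotationOn A (fun k => (v k : E)) q :=
      ⟨congrArg Subtype.val hv.apply_zero, by simpa [B] using congrArg Subtype.val hv.apply_one⟩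
    have hle : 2 ≤ Module.finrank ℝ W := by
      simpa using honv.linearIndependent.fintype_card_le_finrank
    have hne : 2 ≠ Module.finrank ℝ W := fun h2 => by
      obtain ⟨b, hb⟩ := exists_orthonormalBasis_eq_sumElim hon honv h2
      exact hμ.false_of_two_rotations hκ.ne' hA hp hq hu hvA b hb
    omega

end FiniteDimensional

section DirectionalDerivative

variable {σ R : Type*} [CommRing R]

/-- The directional derivative of polynomials along a constant vector, linear in that vector. -/
noncomputable def dirDeriv :
    (σ → R) →ₗ[R] Derivation R (MvPolynomial σ R) (MvPolynomial σ R) :=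
  (mkDerivationEquiv R).toLinearMap ∘ₗ (Algebra.linearMap R (MvPolynomial σ R)).compLeft σ

@[simp]
theorem dirDeriv_X (x : σ → R) (i : σ) : dirDeriv x (X i) = C (x i) :=
  mkDerivation_X _ _ _

theorem dirDeriv_single [DecidableEq σ] (i : σ) :
    dirDeriv (Pi.single i 1) = pderiv (R := R) i :=
  derivation_ext fun j => by simp [Pi.single_apply, pderiv_X, apply_ite C]

theorem dirDeriv_comm (x y : σ → R) (P : MvPolynomial σ R) :
    dirDeriv x (dirDeriv y P) = dirDeriv y (dirDeriv x P) := by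
  have h : ⁅dirDeriv x, dirDeriv y⁆ = 0 :=
    derivation_ext fun i => by simp [Derivation.commutator_apply]
  rw [← sub_eq_zero, ← Derivation.commutator_apply, h, Derivation.zero_apply]

theorem eval_mkDerivation (f : σ → MvPolynomial σ R) (x : σ → R) (P : MvPolynomial σ R) :
    eval x (mkDerivation R f P) = eval x (dirDeriv (fun i => eval x (f i)) P) := by
  induction P using MvPolynomial.induction_on with
  | C a => simp
  | add P Q hP hQ => simp [hP, hQ]
  | mul_X P i hP => simp [hP, Derivation.leibniz]

theorem eval_eq_eval_zero_dirDeriv {Q : MvPolynomial σ R} (hQ : Q.IsHomogeneous 1)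
    (x : σ → R) : eval x Q = eval 0 (dirDeriv x Q) := by
  rw [← mem_homogeneousSubmodule, homogeneousSubmodule_one_eq_span_X] at hQ
  induction hQ using Submodule.span_induction with
  | mem _ h => obtain ⟨i, rfl⟩ := h; simp
  | zero => simp
  | add _ _ _ _ h₁ h₂ => simp [h₁, h₂]
  | smul r _ _ h => simp [h]

variable [Fintype σ]

/-- The derivative of polynomials along the linear vector field `x ↦ A x`. -/
noncomputable def linDeriv (A : Matrix σ σ R) :
    Derivation R (MvPolynomial σ R) (MvPolynomial σ R) :=
  mkDerivation R fun i => ∑ j, C (A i j) * X j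

theorem eval_linDeriv (A : Matrix σ σ R) (x : σ → R) (P : MvPolynomial σ R) :
    eval x (linDeriv A P) = eval x (dirDeriv (A *ᵥ x) P) := by
  simp only [linDeriv, eval_mkDerivation, map_sum, map_mul, eval_C, eval_X]
  rfl

theorem dirDeriv_linDeriv (A : Matrix σ σ R) (x : σ → R) (P : MvPolynomial σ R) :
    dirDeriv x (linDeriv A P) = linDeriv A (dirDeriv x P) + dirDeriv (A *ᵥ x) P := by
  have h : ⁅dirDeriv x, linDeriv A⁆ = dirDeriv (A *ᵥ x) :=
    derivation_ext fun i => by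
      simp [Derivation.commutator_apply, linDeriv, Matrix.mulVec, dotProduct]
  rw [← h, Derivation.commutator_apply]
  abel

end DirectionalDerivative

theorem hasDerivAt_eval {σ 𝕜 : Type*} [NontriviallyNormedField 𝕜] {c : 𝕜 → σ → 𝕜} {c' : σ → 𝕜}
    {t : 𝕜} (hc : ∀ i, HasDerivAt (fun u => c u i) (c' i) t) (P : MvPolynomial σ 𝕜) :
    HasDerivAt (fun u => eval (c u) P) (eval (c t) (dirDeriv c' P)) t := by
  induction P using MvPolynomial.induction_on with
  | C a => simpa using hasDerivAt_const t a
  | add P Q hP hQ => simpa only [map_add] using hP.fun_add hQ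
  | mul_X P i hP =>
    simp only [map_mul, eval_X]
    refine (hP.mul (hc i)).congr_deriv ?_
    simp [Derivation.leibniz]
    ring

section CubicForm

variable {σ R : Type*} [CommRing R] {P : MvPolynomial σ R}

/-- The trilinear form of the third derivatives of a polynomial at the origin. -/
noncomputable def cubicForm (P : MvPolynomial σ R) :
    (σ → R) →ₗ[R] (σ → R) →ₗ[R] (σ → R) →ₗ[R] R :=
  LinearMap.mk₂ R
    (fun x y =>
      { toFun z := eval 0 (dirDeriv x (dirDeriv y (dirDeriv z P)))
        map_add' := by simp
        map_smul' := by simp })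
    (fun _ _ _ => by ext; simp) (fun _ _ _ => by ext; simp) (fun _ _ _ => by ext; simp)
    (fun _ _ _ => by ext; simp)

theorem cubicForm_apply (x y z : σ → R) :
    cubicForm P x y z = eval 0 (dirDeriv x (dirDeriv y (dirDeriv z P))) := rfl

theorem cubicForm_swap₁₂ (x y z : σ → R) : cubicForm P x y z = cubicForm P y x z := by
  simp only [cubicForm_apply, dirDeriv_comm x]

theorem cubicForm_swap₂₃ (x y z : σ → R) : cubicForm P x y z = cubicForm P x z y := by
  simp only [cubicForm_apply, dirDeriv_comm y]

theorem cubicForm_invariant [Fintype σ] {A : Matrix σ σ R} (hA : linDeriv A P = 0)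
    (x y z : σ → R) :
    cubicForm P (A *ᵥ x) y z + cubicForm P x (A *ᵥ y) z + cubicForm P x y (A *ᵥ z) = 0 := by
  have h : eval 0 (dirDeriv x (dirDeriv y (dirDeriv z (linDeriv A P)))) = 0 := by simp [hA]
  simp only [dirDeriv_linDeriv, map_add, eval_linDeriv, Matrix.mulVec_zero, map_zero,
    Derivation.zero_apply, zero_add] at h
  exact h

end CubicForm

theorem trace_mul_mul_self {m R : Type*} [Fintype m] [CommSemiring R] {G H : Matrix m m R}
    (hG : G.IsSymm) (hH : H.IsSymm) :
    (G * H * (G * H)).trace = ∑ i, ∑ j, ∑ k, ∑ l, G i k * G j l * (H i j * H k l) := by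
  simp only [Matrix.trace, Matrix.diag, Matrix.mul_apply, Finset.sum_mul_sum]
  rw [Finset.sum_comm, Finset.sum_congr rfl fun _ _ => Finset.sum_comm, Finset.sum_comm]
  refine Finset.sum_congr rfl fun i _ => Finset.sum_congr rfl fun j _ =>
    Finset.sum_congr rfl fun k _ => Finset.sum_congr rfl fun l _ => ?_
  rw [hG.apply i k, hH.apply k l]
  ring

section Hessian

variable {n : ℕ} {P : MvPolynomial (Fin n) ℝ} {h : Matrix (Fin n) (Fin n) ℝ} {κ : ℝ}

/-- The Hessian matrix of a cubic polynomial, as a linear function of the base point. -/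
noncomputable def hessMatrix (P : MvPolynomial (Fin n) ℝ) :
    (Fin n → ℝ) →ₗ[ℝ] Matrix (Fin n) (Fin n) ℝ :=
  (LinearMap.toMatrix₂' ℝ).toLinearMap ∘ₗ cubicForm P

theorem hessMatrix_apply (z : Fin n → ℝ) (i j : Fin n) :
    hessMatrix P z i j = eval 0 (dirDeriv z (pderiv i (pderiv j P))) := by
  rw [hessMatrix, LinearMap.comp_apply, LinearEquiv.coe_coe, LinearMap.toMatrix₂'_apply,
    cubicForm_apply, dirDeriv_single, dirDeriv_single]

theorem hessMatrix_isSymm (z : Fin n → ℝ) : (hessMatrix P z).IsSymm :=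
  Matrix.IsSymm.ext fun _ _ => cubicForm_swap₂₃ _ _ _

theorem dotProduct_hessMatrix_mulVec (x y z : Fin n → ℝ) :
    y ⬝ᵥ hessMatrix P x *ᵥ z = cubicForm P x y z := by
  rw [← Matrix.toLinearMap₂'_apply', hessMatrix, LinearMap.comp_apply, LinearEquiv.coe_coe,
    Matrix.toLinearMap₂'_toMatrix']

theorem eval_pderiv_pderiv (hP : P.IsHomogeneous 3) (z : Fin n → ℝ) (i j : Fin n) :
    eval z (pderiv i (pderiv j P)) = hessMatrix P z i j := by
  rw [hessMatrix_apply, eval_eq_eval_zero_dirDeriv hP.pderiv.pderiv]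

/-- The multiplication on `ℝⁿ` defined by `h(x ∘ y, z) = D³P(x, y, z)`. -/
noncomputable def mulMap (h : Matrix (Fin n) (Fin n) ℝ) (P : MvPolynomial (Fin n) ℝ) :
    (Fin n → ℝ) →ₗ[ℝ] (Fin n → ℝ) →ₗ[ℝ] (Fin n → ℝ) :=
  Matrix.toLin'.toLinearMap ∘ₗ LinearMap.mulLeft ℝ h⁻¹ ∘ₗ hessMatrix P

theorem mulMap_apply (z : Fin n → ℝ) :
    mulMap h P z = Matrix.toLin' (h⁻¹ * hessMatrix P z) := rfl

theorem dotProduct_mulVec_mulMap (hh : IsUnit h.det) (x y z : Fin n → ℝ) :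
    z ⬝ᵥ h *ᵥ mulMap h P x y = cubicForm P x y z := by
  rw [cubicForm_swap₂₃, ← dotProduct_hessMatrix_mulVec, mulMap_apply, Matrix.toLin'_apply,
    Matrix.mulVec_mulVec, Matrix.mul_nonsing_inv_cancel_left _ _ hh]

theorem trace_mulMap (hP : laplacian h P = 0) (z : Fin n → ℝ) :
    LinearMap.trace ℝ _ (mulMap h P z) = 0 := by
  have hL : eval 0 (dirDeriv z (laplacian h P)) = 0 := by rw [hP, map_zero, map_zero]
  simp only [laplacian, C_mul', map_sum, Derivation.map_smul, smul_eval, ← hessMatrix_apply] at hL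
  rw [mulMap_apply, Matrix.trace_toLin'_eq, ← hL]
  simp only [Matrix.trace, Matrix.diag, Matrix.mul_apply, (hessMatrix_isSymm z).apply]

theorem trace_mulMap_comp_self (hh : h.IsSymm) (hP : IsSolution h κ P) (z : Fin n → ℝ) :
    LinearMap.trace ℝ _ (mulMap h P z ∘ₗ mulMap h P z) = κ * (z ⬝ᵥ h *ᵥ z) := by
  have hE := congrArg (eval z) hP.hess
  simp only [hessNormSq, normSq, map_sum, map_mul, eval_C, eval_X,
    eval_pderiv_pderiv hP.homogeneous] at hE
  rw [mulMap_apply, ← Matrix.toLin'_mul, Matrix.trace_toLin'_eq,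
    trace_mul_mul_self hh.inv (hessMatrix_isSymm z), hE]
  simp only [dotProduct, Matrix.mulVec, Finset.mul_sum, mul_left_comm]

theorem inner_eq_dotProduct_mulVec (hh : h.PosDef) (x y : Fin n → ℝ) :
    letI := h.toNormedAddCommGroup hh
    letI := h.toInnerProductSpace hh.posSemidef
    inner ℝ x y = x ⬝ᵥ h *ᵥ y :=
  dotProduct_comm _ _

theorem inner_mulMap (hh : h.PosDef) (x y z : Fin n → ℝ) :
    letI := h.toNormedAddCommGroup hh
    letI := h.toInnerProductSpace hh.posSemidef
    inner ℝ (mulMap h P x y) z = cubicForm P x y z := by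
  have hsymm : hᵀ = h := hh.isHermitian
  rw [← dotProduct_mulVec_mulMap hh.det_pos.ne'.isUnit, inner_eq_dotProduct_mulVec hh,
    Matrix.dotProduct_mulVec, ← Matrix.mulVec_transpose, hsymm, dotProduct_comm]

theorem isExactKillingMetrized_mulMap (hh : h.PosDef) (hP : IsSolution h κ P) :
    letI := h.toNormedAddCommGroup hh
    letI := h.toInnerProductSpace hh.posSemidef
    IsExactKillingMetrized (mulMap h P) κ := by
  let _ := h.toNormedAddCommGroup hh
  let _ := h.toInnerProductSpace hh.posSemidef
  have hsymm : h.IsSymm := hh.isHermitian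
  refine ⟨fun x y => ext_inner_right ℝ fun z => ?_, fun x y z => ?_,
    fun x => trace_mulMap hP.harmonic x, fun x => ?_⟩
  · rw [inner_mulMap hh, inner_mulMap hh, cubicForm_swap₁₂]
  · rw [inner_mulMap hh, inner_eq_dotProduct_mulVec hh,
      dotProduct_mulVec_mulMap hh.det_pos.ne'.isUnit, cubicForm_swap₂₃]
  · rw [trace_mulMap_comp_self hsymm hP, inner_eq_dotProduct_mulVec hh]

theorem isSkewDerivation_toLin' (hh : h.PosDef) {A : Matrix (Fin n) (Fin n) ℝ}
    (hA : Aᵀ * h + h * A = 0) (hAP : linDeriv A P = 0) :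
    letI := h.toNormedAddCommGroup hh
    letI := h.toInnerProductSpace hh.posSemidef
    IsSkewDerivation (mulMap h P) (Matrix.toLin' A) := by
  let _ := h.toNormedAddCommGroup hh
  let _ := h.toInnerProductSpace hh.posSemidef
  refine isSkewDerivation_iff.2 ⟨fun x y => ?_, fun x y z => ?_⟩
  · rw [inner_eq_dotProduct_mulVec hh, inner_eq_dotProduct_mulVec hh, Matrix.toLin'_apply,
      Matrix.toLin'_apply, Matrix.mulVec_mulVec, eq_neg_of_add_eq_zero_right hA,
      Matrix.neg_mulVec, dotProduct_neg, neg_neg, ← Matrix.mulVec_mulVec,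
      Matrix.dotProduct_mulVec x, Matrix.vecMul_transpose]
  · simp only [inner_mulMap hh, Matrix.toLin'_apply]
    exact cubicForm_invariant hAP x y z

end Hessian

section OneParameterSubgroups

variable {n : ℕ} {P : MvPolynomial (Fin n) ℝ} {h A : Matrix (Fin n) (Fin n) ℝ}

theorem exists_exp_mem_of_lieDimension_pos {G : Subgroup (GL (Fin n) ℝ)}
    (hG : 0 < lieDimension G) :
    ∃ A : Matrix (Fin n) (Fin n) ℝ, A ≠ 0 ∧
      ∀ t : ℝ, ∃ g ∈ G, (g : Matrix (Fin n) (Fin n) ℝ) = NormedSpace.exp (t • A) := by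
  by_contra! hc
  have hbot : lieAlgebra G = ⊥ := Submodule.span_eq_bot.2 fun A hA => by
    by_contra hA0
    obtain ⟨t, ht⟩ := hc A hA0
    obtain ⟨g, hg, hgt⟩ := hA t
    exact ht g hg hgt
  rw [lieDimension, hbot, finrank_bot] at hG
  exact hG.ne rfl

section Derivative

attribute [local instance] Matrix.linftyOpNormedRing Matrix.linftyOpNormedAlgebra

theorem hasDerivAt_exp_smul_zero (A : Matrix (Fin n) (Fin n) ℝ) :
    HasDerivAt (fun t : ℝ => NormedSpace.exp (t • A)) A 0 := by
  have hderiv := hasDerivAt_exp_smul_const (𝕂 := ℝ) A 0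
  rw [zero_smul, NormedSpace.exp_zero, one_mul] at hderiv
  exact hderiv

theorem hasDerivAt_exp_smul_mulVec (A : Matrix (Fin n) (Fin n) ℝ) (x : Fin n → ℝ) (i : Fin n) :
    HasDerivAt (fun t : ℝ => (NormedSpace.exp (t • A) *ᵥ x) i) ((A *ᵥ x) i) 0 := by
  simp only [Matrix.mulVec, dotProduct]
  exact HasDerivAt.fun_sum fun j _ =>
    (hasDerivAt_pi.1 (hasDerivAt_pi.1 (hasDerivAt_exp_smul_zero A) i) j).mul_const (x j)

theorem transpose_mul_add_mul_eq_zero_of_forall_exp_mem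
    (hA : ∀ t : ℝ, ∃ g ∈ automorphismGroup h P,
      (g : Matrix (Fin n) (Fin n) ℝ) = NormedSpace.exp (t • A)) :
    Aᵀ * h + h * A = 0 := by
  have hderiv := ((hasDerivAt_exp_smul_zero Aᵀ).mul_const h).fun_mul (hasDerivAt_exp_smul_zero A)
  have hconst : (fun t : ℝ => NormedSpace.exp (t • Aᵀ) * h * NormedSpace.exp (t • A)) =
      fun _ => h := by
    funext t
    obtain ⟨g, ⟨hg, -⟩, hgt⟩ := hA t
    rw [← Matrix.transpose_smul, Matrix.exp_transpose, ← hgt, hg]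
  rw [hconst] at hderiv
  simpa using hderiv.unique (hasDerivAt_const 0 h)

end Derivative

theorem linDeriv_eq_zero_of_forall_exp_mem
    (hA : ∀ t : ℝ, ∃ g ∈ automorphismGroup h P,
      (g : Matrix (Fin n) (Fin n) ℝ) = NormedSpace.exp (t • A)) :
    linDeriv A P = 0 := by
  refine MvPolynomial.funext fun x => ?_
  have hderiv := hasDerivAt_eval (hasDerivAt_exp_smul_mulVec A x) P
  have hconst : (fun t : ℝ => eval (NormedSpace.exp (t • A) *ᵥ x) P) = fun _ => eval x P := by
    funext t
    obtain ⟨g, ⟨-, hg⟩, hgt⟩ := hA t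
    rw [← hgt, hg]
  rw [hconst] at hderiv
  simpa [eval_linDeriv] using hderiv.unique (hasDerivAt_const 0 _)

theorem five_le_of_forall_exp_mem {κ : ℝ} (hh : h.PosDef) (hκ : 0 < κ) (hP : IsSolution h κ P)
    (hA0 : A ≠ 0)
    (hA : ∀ t : ℝ, ∃ g ∈ automorphismGroup h P,
      (g : Matrix (Fin n) (Fin n) ℝ) = NormedSpace.exp (t • A)) :
    5 ≤ n := by
  let _ := h.toNormedAddCommGroup hh
  let _ := h.toInnerProductSpace hh.posSemidef
  have hder : IsSkewDerivation (mulMap h P) (Matrix.toLin' A) :=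
    isSkewDerivation_toLin' hh (transpose_mul_add_mul_eq_zero_of_forall_exp_mem hA)
      (linDeriv_eq_zero_of_forall_exp_mem hA)
  have hA0' : Matrix.toLin' A ≠ 0 := Matrix.toLin'.map_ne_zero_iff.2 hA0
  simpa using (isExactKillingMetrized_mulMap hh hP).five_le_finrank hκ hder hA0'

end OneParameterSubgroups

end EinsteinPolynomial

theorem mainTheorem10 (n : ℕ) (h : Matrix (Fin n) (Fin n) ℝ) (hh : h.PosDef) (κ : ℝ) (hκ : 0 < κ)
    (P : MvPolynomial (Fin n) ℝ) (hP : EinsteinPolynomial.IsSolution h κ P)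
    (hdim : 0 < EinsteinPolynomial.lieDimension (EinsteinPolynomial.automorphismGroup h P)) :
    5 ≤ n := by
  obtain ⟨A, hA0, hA⟩ := EinsteinPolynomial.exists_exp_mem_of_lieDimension_pos hdim
  exact EinsteinPolynomial.five_le_of_forall_exp_mem hh hκ hP hA0 hA
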